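/- Let $(\Omega,\Sigma,P)$ be a probability space. A counting process is a family $N=\{N_t\}_{t\ge 0}$ of $\mathbb N_0$-valued random variables (no explosion) such that, for every $\omega\in\Omega$: $N_0(\omega)=0$; $N_t(\omega)=\inf_{s>t}N_s(\omega)$ for all $t\ge0$; $\sup_{s<t}N_s(\omega)\le N_t(\omega)\le \sup_{s<t}N_s(\omega)+1$ for all $t>0$; and $\sup_{t\ge0}N_t(\omega)=\infty$. A risk process is a pair $(N,X)$ consisting of a counting process $N$ and an i.i.d. sequence $X=\{X_n\}_{n\ge1}$ of positive random variables such that the processes $N$ and $X$ are independent; the aggregate process induced by it is $S=\{S_t\}_{t\ge0}$, $S_t:=\sum_{k=1}^{N_t}X_k$. For $\theta>0$, a counting process $N$ is a Poisson process with parameter $\theta$ if it has independent and stationary increments and $N_t$ has the Poisson distribution with parameter $t\theta$ for every $t>0$. A process $S$ is a compound Poisson process with parameters $\theta$ and $\mu$, written $\mathrm{CPP}(\theta,\mu)$, if it is the aggregate process induced by some risk process $(N',X')$ on $(\Omega,\Sigma,P)$ such that $N'$ is a Poisson process with parameter $\theta$ and $X'_1$ has law $\mu$. For a process $Z$, let $\mathcal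 F^Z=\{\sigma(Z_s: s\le t)\}_{t\ge0}$ denote its canonical filtration. Corollary 3.5. Let $S$ be the aggregate process induced by a risk process $(N,X)$ and assume that $X_1$ is $P$-integrable. Let $P_{X_1}$ denote the law of $X_1$. For every $\theta_0>0$ the following statements are equivalent: (i) $S$ is a $\mathrm{CPP}(\theta_0,P_{X_1})$; (ii) $\{S_t-t\theta_0\mathbb E_P[X_1]\}_{t\ge0}$ is an $\mathcal F^S$-martingale in $\mathcal L^1(P)$; (iii) $\{N_t-t\theta_0\}_{t\ge0}$ is an $\mathcal F^N$-martingale in $\mathcal L^1(P)$; (iv) $N$ is a Poisson process with parameter $\theta_0$. -/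

import Mathlib

open MeasureTheory ProbabilityTheory
open scoped NNReal

/-- A counting process `N = (N_t)_{t ≥ 0}` without explosion: each `N t` is a random variable with
values in `ℕ`, and every path starts at `0`, is nondecreasing and right-continuous, has jumps of
height at most one, and increases to infinity. -/
structure IsCountingProcess {Ω : Type*} [MeasurableSpace Ω] (N : ℝ≥0 → Ω → ℕ) : Prop where
  measurable : ∀ t, Measurable (N t)
  zero : ∀ ω, N 0 ω = 0
  /-- `N_t = inf_{s > t} N_s`. -/
  isGLB : ∀ t ω, IsGLB ((fun s => N s ω) '' Set.Ioi t) (N t ω)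
  /-- `N_t ≤ sup_{s < t} N_s + 1` (the supremum is a maximum, the paths being nondecreasing and
  `ℕ`-valued). -/
  jump_le_one : ∀ t, 0 < t → ∀ ω, ∃ s, s < t ∧ N t ω ≤ N s ω + 1
  /-- `sup_t N_t = ∞`. -/
  unbounded : ∀ ω, ∀ n : ℕ, ∃ t, n ≤ N t ω

/-- A risk process `(N, X)` with positive sizes: `N` is a counting process, `X` is an i.i.d.
sequence of positive random variables, and the processes `N` and `X` are independent.
The sequence is indexed from `0`: `X n` is the size of the `(n+1)`-st claim, so `X 0` is the
first claim size. -/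
structure IsRiskProcess {Ω : Type*} [MeasurableSpace Ω] (P : Measure Ω)
    (N : ℝ≥0 → Ω → ℕ) (X : ℕ → Ω → ℝ) : Prop where
  counting : IsCountingProcess N
  measurable : ∀ n, Measurable (X n)
  pos : ∀ n ω, 0 < X n ω
  iIndepFun : iIndepFun X P
  identDistrib : ∀ n, IdentDistrib (X n) (X 0) P P
  indepFun : IndepFun (fun ω t => N t ω) (fun ω n => X n ω) P

/-- The aggregate process induced by `N` and `X`: the sum `S_t` of the first `N_t` sizes. -/
def aggregateProcess {Ω : Type*} (N : ℝ≥0 → Ω → ℕ) (X : ℕ → Ω → ℝ) : ℝ≥0 → Ω → ℝ :=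
  fun t ω => ∑ k ∈ Finset.range (N t ω), X k ω

/-- `N` is a Poisson process with parameter `θ`: a counting process with independent and stationary
increments such that `N_t` has the Poisson law with parameter `t θ` for every `t > 0`.
(The paths of `N` are nondecreasing, so the subtraction in `ℕ` is the true one.) -/
structure IsPoissonProcess {Ω : Type*} [MeasurableSpace Ω] (P : Measure Ω)
    (N : ℝ≥0 → Ω → ℕ) (θ : ℝ≥0) : Prop where
  counting : IsCountingProcess N
  indepIncrements : HasIndepIncrements N P
  stationaryIncrements : ∀ s t h : ℝ≥0, s ≤ t →
    P.map (fun ω => N (t + h) ω - N (s + h) ω) = P.map (fun ω => N t ω - N s ω)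
  law : ∀ t : ℝ≥0, 0 < t → P.map (N t) = poissonMeasure (t * θ)

/-- `S` is a compound Poisson process with parameters `θ` and `μ`: it is the aggregate process
induced by some risk process `(N, X)` such that `N` is a Poisson process with parameter `θ` and
the sizes have law `μ`. -/
def IsCompoundPoissonProcess {Ω : Type*} [MeasurableSpace Ω] (P : Measure Ω)
    (S : ℝ≥0 → Ω → ℝ) (θ : ℝ≥0) (μ : Measure ℝ) : Prop :=
  ∃ (N : ℝ≥0 → Ω → ℕ) (X : ℕ → Ω → ℝ), IsRiskProcess P N X ∧ S = aggregateProcess N X ∧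
    IsPoissonProcess P N θ ∧ P.map (X 0) = μ

theorem IsCountingProcess.stronglyMeasurable {Ω : Type*} [MeasurableSpace Ω]
    {N : ℝ≥0 → Ω → ℕ} (h : IsCountingProcess N) (t : ℝ≥0) : StronglyMeasurable (N t) :=
  (h.measurable t).stronglyMeasurable

theorem IsRiskProcess.stronglyMeasurable_aggregateProcess {Ω : Type*} [MeasurableSpace Ω]
    {P : Measure Ω} {N : ℝ≥0 → Ω → ℕ} {X : ℕ → Ω → ℝ} (h : IsRiskProcess P N X) (t : ℝ≥0) :
    StronglyMeasurable (aggregateProcess N X t) := by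
  have h1 : Measurable (fun p : ℕ × Ω => ∑ k ∈ Finset.range p.1, X k p.2) :=
    measurable_from_prod_countable_right
      (fun n => Finset.measurable_fun_sum (Finset.range n) (fun k _ => h.measurable k))
  exact (h1.comp ((h.counting.measurable t).prodMk measurable_id)).stronglyMeasurable

/-! Sizes are positive, so `S` jumps exactly when `N` does and `N` is a pathwise functional of `S`.
Hence every risk process inducing `S` has the same claim number process
(`IsRiskProcess.eq_of_aggregateProcess_eq`), which gives (i) ⇔ (iv), and the filtration of `N` is
contained in that of `S`.

For the martingale statements, Wald's identity `IsRiskProcess.setLIntegral_aggregateProcess_sub`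
gives `E[(S_t - S_s) 1_A] = E[X_1] E[(N_t - N_s) 1_A]` for `A` in the past of `S`. As `E[X_1]` is
positive and finite, (ii) says precisely that `E[(N_t - N_s) 1_A] = (t - s) θ₀ P(A)` for all such
`A`. Independence of increments and of sizes yields this from (iv); restricting to `A` in the past
of `N` yields (iii).

The implication (iii) ⇒ (iv) is Watanabe's theorem, proved without stochastic calculus. For `‖z‖ ≤
1` and `A` in the past of `N` at `s`, follow `E[1_A z^(N_u - N_s)]` along a uniform partition of
`[s, t]`. Each step multiplies it by `1 + (z - 1) θ₀ (t - s) / m`, up to an error controlled by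
increments of size at least two. Unit jumps make the total error vanish as `m → ∞`, leaving `exp (θ₀
(t - s) (z - 1)) P(A)`: the increment is Poisson and independent of the past. -/

/-! ### Independence of σ-algebras and of sequences -/

section Independence

variable {Ω : Type*} {mΩ : MeasurableSpace Ω} {μ : Measure Ω}

theorem isPiSystem_inter_measurableSet (m₁ m₂ : MeasurableSpace Ω) :
    IsPiSystem {s | ∃ a b, MeasurableSet[m₁] a ∧ MeasurableSet[m₂] b ∧ s = a ∩ b} := by
  rintro _ ⟨a, b, ha, hb, rfl⟩ _ ⟨c, d, hc, hd, rfl⟩ -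
  exact ⟨a ∩ c, b ∩ d, ha.inter hc, hb.inter hd, Set.inter_inter_inter_comm a b c d⟩

theorem sup_eq_generateFrom_inter_measurableSet (m₁ m₂ : MeasurableSpace Ω) :
    m₁ ⊔ m₂ = MeasurableSpace.generateFrom
      {s | ∃ a b, MeasurableSet[m₁] a ∧ MeasurableSet[m₂] b ∧ s = a ∩ b} := by
  apply le_antisymm
  · refine sup_le (fun a ha => ?_) (fun b hb => ?_)
    · exact MeasurableSpace.measurableSet_generateFrom
        ⟨a, Set.univ, ha, MeasurableSet.univ, (Set.inter_univ a).symm⟩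
    · exact MeasurableSpace.measurableSet_generateFrom
        ⟨Set.univ, b, MeasurableSet.univ, hb, (Set.univ_inter b).symm⟩
  · refine MeasurableSpace.generateFrom_le ?_
    rintro _ ⟨a, b, ha, hb, rfl⟩
    exact MeasurableSet.inter ((le_sup_left : m₁ ≤ m₁ ⊔ m₂) a ha)
      ((le_sup_right : m₂ ≤ m₁ ⊔ m₂) b hb)

/-- On the π-system of intersections `a ∩ b`, split off `a` from `b ∩ c`, then `b` from `c`, and
recombine `a` with `b`. -/
theorem ProbabilityTheory.Indep.sup_left_of_indep_sup [IsProbabilityMeasure μ]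
    {m₁ m₂ m₃ : MeasurableSpace Ω} (h₁ : m₁ ≤ mΩ) (h₂ : m₂ ≤ mΩ) (h₃ : m₃ ≤ mΩ)
    (h : Indep m₁ (m₂ ⊔ m₃) μ) (h' : Indep m₂ m₃ μ) : Indep (m₁ ⊔ m₂) m₃ μ := by
  refine IndepSets.indep (sup_le h₁ h₂) h₃ (isPiSystem_inter_measurableSet m₁ m₂)
    (@MeasurableSpace.isPiSystem_measurableSet _ m₃)
    (sup_eq_generateFrom_inter_measurableSet m₁ m₂)
    (@MeasurableSpace.generateFrom_measurableSet _ m₃).symm ?_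
  rw [IndepSets_iff]
  rintro _ c ⟨a, b, ha, hb, rfl⟩ hc
  rw [Indep_iff] at h h'
  have hb' : MeasurableSet[m₂ ⊔ m₃] b := (le_sup_left : m₂ ≤ m₂ ⊔ m₃) b hb
  have hc' : MeasurableSet[m₂ ⊔ m₃] c := (le_sup_right : m₃ ≤ m₂ ⊔ m₃) c hc
  rw [Set.inter_assoc, h a (b ∩ c) ha (hb'.inter hc'), h' b c hb hc, h a b ha hb', mul_assoc]

/-- Induction on finite index sets, removing the largest index: all other factors lie in its past.
-/
theorem iIndepFun_of_indep_past {E : Type*} [MeasurableSpace E] [IsProbabilityMeasure μ]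
    {f : ℕ → Ω → E} {m : ℕ → MeasurableSpace Ω}
    (hf : ∀ i j, i < j → Measurable[m j] (f i))
    (h : ∀ j, Indep (m j) (MeasurableSpace.comap (f j) inferInstance) μ) : iIndepFun f μ := by
  rw [iIndepFun_iff_measure_inter_preimage_eq_mul]
  intro S
  induction S using Finset.induction_on_max with
  | empty => simp
  | insert a s has ih =>
    intro sets H
    have ha : a ∉ s := fun h => lt_irrefl a (has a h)
    rw [Finset.prod_insert ha, Finset.set_biInter_insert, Set.inter_comm,
      (Indep_iff _ _ _).1 (h a) _ _ _ ⟨sets a, H a (Finset.mem_insert_self a s), rfl⟩,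
      ih fun i hi => H i (Finset.mem_insert_of_mem hi), mul_comm]
    exact Finset.measurableSet_biInter s fun i hi =>
      hf i a (has i hi) (H i (Finset.mem_insert_of_mem hi))

end Independence

/-! ### Paths of counting processes -/

namespace IsCountingProcess

variable {Ω : Type*} [MeasurableSpace Ω] {N : ℝ≥0 → Ω → ℕ}

theorem mono (h : IsCountingProcess N) (ω : Ω) : Monotone fun t => N t ω := by
  intro s t hst
  rcases hst.eq_or_lt with rfl | hst
  · exact le_rfl
  · exact (h.isGLB s ω).1 ⟨t, hst, rfl⟩

/-- An infimum of naturals is attained, so right-continuity means being constant for a while after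
`t`. -/
theorem exists_gt_eq (h : IsCountingProcess N) (t : ℝ≥0) (ω : Ω) : ∃ s, t < s ∧ N s ω = N t ω := by
  by_contra! hne
  have : N t ω + 1 ≤ N t ω := by
    refine (h.isGLB t ω).2 ?_
    rintro _ ⟨s, hs, rfl⟩
    exact lt_of_le_of_ne (h.mono ω (le_of_lt hs)) (hne s hs).symm
  omega

/-- Having jumps of height one, the paths do not skip any integer. -/
theorem exists_lt_eq (h : IsCountingProcess N) {t : ℝ≥0} {ω : Ω} {n : ℕ} (hn : n < N t ω) :
    ∃ s < t, N s ω = n := by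
  set A : Set ℝ≥0 := {u | n < N u ω} with hA
  have hne : A.Nonempty := ⟨t, hn⟩
  -- The first time the path exceeds `n`: right-continuity puts `u` itself in `A`, and the jump
  -- bound then forces the value `n` just before `u`.
  set u := sInf A with hu
  have hmem : n < N u ω := by
    obtain ⟨v, huv, hv⟩ := h.exists_gt_eq u ω
    obtain ⟨a, ha, hav⟩ := exists_lt_of_csInf_lt hne huv
    exact hv ▸ lt_of_lt_of_le ha (h.mono ω hav.le)
  have hpos : 0 < u := by
    rcases eq_zero_or_pos u with h0 | h0
    · rw [h0, h.zero] at hmem; omega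
    · exact h0
  obtain ⟨s, hs, hsu⟩ := h.jump_le_one u hpos ω
  have hns : ¬ n < N s ω := fun hc => not_le.2 hs (csInf_le' hc)
  exact ⟨s, lt_of_lt_of_le hs (csInf_le' hn), by omega⟩

/-- The level `n` is held on a nondegenerate interval, which contains a rational. Rational times
later make unions countable. -/
theorem exists_nnrat_eq (h : IsCountingProcess N) {t : ℝ≥0} {ω : Ω} {n : ℕ} (hn : n < N t ω) :
    ∃ q : ℚ≥0, (q : ℝ≥0) < t ∧ N q ω = n := by
  obtain ⟨s, -, hs⟩ := h.exists_lt_eq hn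
  obtain ⟨v, hsv, hv⟩ := h.exists_gt_eq s ω
  obtain ⟨q, hsq, hqv⟩ := exists_rat_btwn (NNReal.coe_lt_coe.2 hsv)
  have hq0 : 0 ≤ q := by exact_mod_cast (s.2.trans hsq.le)
  lift q to ℚ≥0 using hq0
  have hsq' : s < (q : ℝ≥0) := by exact_mod_cast hsq
  have hqv' : (q : ℝ≥0) < v := by exact_mod_cast hqv
  have hq : N q ω = n := by
    have h1 := h.mono ω hsq'.le
    have h2 := h.mono ω hqv'.le
    simp only at h1 h2
    omega
  refine ⟨q, ?_, hq⟩
  by_contra! hc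
  have := h.mono ω hc
  simp only at this
  omega

/-- Around every time point the path has increments of height at most one. -/
theorem exists_ball_le_add_one (h : IsCountingProcess N) (u : ℝ≥0) (ω : Ω) :
    ∃ ε > 0, ∀ x ∈ Metric.ball u ε, ∀ y ∈ Metric.ball u ε, N y ω ≤ N x ω + 1 := by
  obtain ⟨v, huv, hv⟩ := h.exists_gt_eq u ω
  have hlow : ∃ ε > (0 : ℝ), ∀ x : ℝ≥0, (u : ℝ) - ε < x → N u ω ≤ N x ω + 1 := by
    rcases eq_zero_or_pos u with h0 | h0
    · exact ⟨1, one_pos, fun x _ => by rw [h0, h.zero]; omega⟩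
    · obtain ⟨s, hs, hsu⟩ := h.jump_le_one u h0 ω
      refine ⟨u - s, sub_pos.2 (NNReal.coe_lt_coe.2 hs), fun x hx => hsu.trans ?_⟩
      have hsx : s ≤ x := by
        have : (s : ℝ) < x := by linarith
        exact_mod_cast this.le
      exact Nat.add_le_add_right (h.mono ω hsx) 1
  obtain ⟨ε, hε, hεx⟩ := hlow
  refine ⟨min ε (v - u), lt_min hε (sub_pos.2 (NNReal.coe_lt_coe.2 huv)), fun x hx y hy => ?_⟩
  rw [Metric.mem_ball, NNReal.dist_eq, abs_lt] at hx hy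
  have hyv : y ≤ v := by
    have h1 := min_le_right ε ((v : ℝ) - u)
    have : (y : ℝ) < v := by linarith
    exact_mod_cast this.le
  have hxu : N u ω ≤ N x ω + 1 := hεx x (by linarith [min_le_left ε ((v : ℝ) - u)])
  exact (h.mono ω hyv).trans (hv.le.trans hxu)

end IsCountingProcess

/-! ### Recovering the claim number from the aggregate process -/

section Aggregate

variable {Ω : Type*} [MeasurableSpace Ω] {P : Measure Ω} {N : ℝ≥0 → Ω → ℕ} {X : ℕ → Ω → ℝ}

theorem IsRiskProcess.aggregateProcess_lt_iff (hNX : IsRiskProcess P N X) {s t : ℝ≥0} {ω : Ω} :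
    aggregateProcess N X s ω < aggregateProcess N X t ω ↔ N s ω < N t ω := by
  have hmono : StrictMono fun n => ∑ k ∈ Finset.range n, X k ω :=
    strictMono_nat_of_lt_succ fun n => by
      rw [Finset.sum_range_succ]
      exact lt_add_of_pos_right _ (hNX.pos n ω)
  exact hmono.lt_iff_lt

theorem IsRiskProcess.aggregateProcess_mono (hNX : IsRiskProcess P N X) (ω : Ω) :
    Monotone fun t => aggregateProcess N X t ω := fun s t hst => by
  by_contra! hc
  exact absurd (hNX.counting.mono ω hst) (not_le.2 (hNX.aggregateProcess_lt_iff.1 hc))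

/-- The claim number is recovered from the aggregate process by counting its jumps. -/
theorem IsRiskProcess.succ_le_iff (hNX : IsRiskProcess P N X) {t : ℝ≥0} {ω : Ω} {n : ℕ} :
    n + 1 ≤ N t ω ↔ ∃ q : ℚ≥0, (q : ℝ≥0) < t ∧ n ≤ N q ω ∧
      aggregateProcess N X q ω < aggregateProcess N X t ω := by
  constructor
  · intro hn
    obtain ⟨q, hqt, hq⟩ := hNX.counting.exists_nnrat_eq (Nat.lt_of_succ_le hn)
    exact ⟨q, hqt, hq.ge, hNX.aggregateProcess_lt_iff.2 (by omega)⟩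
  · rintro ⟨q, -, hq, hlt⟩
    have := hNX.aggregateProcess_lt_iff.1 hlt
    omega

/-- In `succ_le_iff` the level `n + 1` is described by the aggregate process and the level `n`
alone, so induction on the level determines `N`. -/
theorem IsRiskProcess.eq_of_aggregateProcess_eq {N' : ℝ≥0 → Ω → ℕ} {X' : ℕ → Ω → ℝ}
    (hNX : IsRiskProcess P N X) (h' : IsRiskProcess P N' X')
    (heq : aggregateProcess N X = aggregateProcess N' X') : N = N' := by
  have key : ∀ n t ω, n ≤ N t ω ↔ n ≤ N' t ω := by
    intro n
    induction n with
    | zero => simp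
    | succ n ih =>
      intro t ω
      rw [hNX.succ_le_iff, h'.succ_le_iff, heq]
      simp only [ih]
  funext t ω
  exact eq_of_forall_le_iff fun n => key n t ω

theorem IsRiskProcess.measurable_natural_aggregateProcess (hNX : IsRiskProcess P N X) (t : ℝ≥0) :
    Measurable[Filtration.natural _ hNX.stronglyMeasurable_aggregateProcess t] (N t) := by
  set F := Filtration.natural _ hNX.stronglyMeasurable_aggregateProcess
  have hS : ∀ s t, s ≤ t → Measurable[F t] (aggregateProcess N X s) := fun s t hst =>
    ((Filtration.stronglyAdapted_natural hNX.stronglyMeasurable_aggregateProcess s).measurable).mono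
      (F.mono hst) le_rfl
  have key : ∀ n t, MeasurableSet[F t] {ω | n ≤ N t ω} := by
    intro n
    induction n with
    | zero => simp
    | succ n ih =>
      intro t
      simp only [hNX.succ_le_iff, Set.ofPred_exists]
      refine MeasurableSet.iUnion fun q => ?_
      by_cases hq : (q : ℝ≥0) < t
      · simp only [hq, true_and]
        exact (F.mono hq.le _ (ih q)).inter (measurableSet_lt (hS q t hq.le) (hS t t le_rfl))
      · simp [hq]
  exact measurable_of_Ici fun n => key n t

theorem IsRiskProcess.natural_le_natural_aggregateProcess (hNX : IsRiskProcess P N X) (t : ℝ≥0) :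
    Filtration.natural N hNX.counting.stronglyMeasurable t ≤
      Filtration.natural _ hNX.stronglyMeasurable_aggregateProcess t :=
  iSup₂_le fun s hs => (hNX.measurable_natural_aggregateProcess s).comap_le.trans
    ((Filtration.natural _ hNX.stronglyMeasurable_aggregateProcess).mono hs)

theorem IsRiskProcess.isCompoundPoissonProcess_iff (hNX : IsRiskProcess P N X) (θ : ℝ≥0) :
    IsCompoundPoissonProcess P (aggregateProcess N X) θ (P.map (X 0)) ↔
      IsPoissonProcess P N θ := by
  refine ⟨?_, fun hN => ⟨N, X, hNX, rfl, hN, rfl⟩⟩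
  rintro ⟨N', X', h', heq, hN', -⟩
  rwa [hNX.eq_of_aggregateProcess_eq h' heq]

end Aggregate

/-! ### Estimates for Watanabe's theorem -/

section Watanabe

/-- The first-order expansion of `z ^ n` at `z = 1` is exact for `n ≤ 1`; for `n ≥ 2` the crude
bound `2 + 2 * n ≤ 3 * n` suffices. -/
theorem norm_pow_sub_one_sub_mul_le {z : ℂ} (hz : ‖z‖ ≤ 1) (n : ℕ) :
    ‖z ^ n - 1 - (z - 1) * n‖ ≤ 3 * (if n ≤ 1 then 0 else (n : ℝ)) := by
  split_ifs with h
  · interval_cases n <;> simp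
  · have hn : (2 : ℝ) ≤ n := by exact_mod_cast (not_le.1 h)
    have h1 : ‖z ^ n‖ ≤ 1 := by rw [norm_pow]; exact pow_le_one₀ (norm_nonneg z) hz
    have h2 : ‖z - 1‖ ≤ 2 := (norm_sub_le _ _).trans (by rw [norm_one]; linarith)
    calc ‖z ^ n - 1 - (z - 1) * n‖ ≤ ‖z ^ n‖ + ‖(1 : ℂ)‖ + ‖(z - 1) * n‖ :=
          (norm_sub_le _ _).trans (by gcongr; exact norm_sub_le _ _)
      _ ≤ 1 + 1 + 2 * n := by
          rw [norm_one, norm_mul, Complex.norm_natCast]; gcongr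
      _ ≤ 3 * n := by linarith

/-- Since `‖q‖ ≤ 1`, the recursion does not amplify earlier errors; they merely add up. -/
theorem norm_sub_pow_mul_le {a : ℕ → ℂ} {q : ℂ} {ε : ℕ → ℝ} (hq : ‖q‖ ≤ 1) (m : ℕ)
    (h : ∀ i < m, ‖a (i + 1) - q * a i‖ ≤ ε i) :
    ‖a m - q ^ m * a 0‖ ≤ ∑ i ∈ Finset.range m, ε i := by
  induction m with
  | zero => simp
  | succ m ih =>
    rw [Finset.sum_range_succ]
    calc ‖a (m + 1) - q ^ (m + 1) * a 0‖
        = ‖q * (a m - q ^ m * a 0) + (a (m + 1) - q * a m)‖ := by ring_nf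
      _ ≤ ‖q * (a m - q ^ m * a 0)‖ + ‖a (m + 1) - q * a m‖ := norm_add_le _ _
      _ ≤ 1 * ‖a m - q ^ m * a 0‖ + ε m := by
          rw [norm_mul]; gcongr; exact h m (Nat.lt_succ_self m)
      _ ≤ _ := by
          rw [one_mul]; gcongr; exact ih fun i hi => h i (hi.trans (Nat.lt_succ_self m))

/-- One step of the partition: `W` is known at the start of the step, so conditioning replaces the
linear term in `D` by `c`, and only values `D ≥ 2` leave an error. -/
theorem norm_integral_mul_pow_sub_le {Ω : Type*} {m mΩ : MeasurableSpace Ω} {P : Measure Ω}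
    [IsProbabilityMeasure P] (hm : m ≤ mΩ) {W : Ω → ℂ} (hW : StronglyMeasurable[m] W)
    (hW1 : ∀ ω, ‖W ω‖ ≤ 1) {D : Ω → ℕ} (hD : Measurable D)
    (hDi : Integrable (fun ω => (D ω : ℝ)) P) {c : ℝ}
    (hc : P[fun ω => (D ω : ℝ) | m] =ᵐ[P] fun _ => c) {z : ℂ} (hz : ‖z‖ ≤ 1) :
    ‖∫ ω, W ω * z ^ D ω ∂P - (1 + (z - 1) * c) * ∫ ω, W ω ∂P‖ ≤
      3 * ∫ ω, (if D ω ≤ 1 then 0 else (D ω : ℝ)) ∂P := by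
  have hWm : AEStronglyMeasurable W P := (hW.mono hm).aestronglyMeasurable
  have hWi : Integrable W P := .of_bound hWm 1 (.of_forall hW1)
  have hWz : Integrable (fun ω => W ω * z ^ D ω) P := by
    refine .of_bound (hWm.mul ?_) 1 (.of_forall fun ω => ?_)
    · exact ((measurable_from_nat (f := fun n => z ^ n)).comp hD).aestronglyMeasurable
    · rw [norm_mul, norm_pow]
      exact mul_le_one₀ (hW1 ω) (by positivity) (pow_le_one₀ (norm_nonneg z) hz)
  have hDW : Integrable (fun ω => (D ω : ℝ) • W ω) P := by
    refine hDi.mono' (hDi.aestronglyMeasurable.smul hWm) (.of_forall fun ω => ?_)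
    rw [norm_smul, Real.norm_natCast]
    exact mul_le_of_le_one_right (Nat.cast_nonneg _) (hW1 ω)
  have hpull : ∫ ω, (D ω : ℝ) • W ω ∂P = c * ∫ ω, W ω ∂P := by
    have h : P[fun ω => (D ω : ℝ) • W ω | m] =ᵐ[P] P[fun ω => (D ω : ℝ) | m] • W :=
      condExp_smul_of_aestronglyMeasurable_right hDi hDW hW.aestronglyMeasurable
    rw [← integral_condExp hm, integral_congr_ae (h.trans (hc.smul (.refl _ W)))]
    simp only [Complex.real_smul]
    exact integral_const_mul (c : ℂ) W
  have hsmall : Integrable (fun ω => if D ω ≤ 1 then 0 else (D ω : ℝ)) P := by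
    refine hDi.mono' ((measurable_from_nat (f := fun n => if n ≤ 1 then 0 else (n : ℝ))).comp
      hD).aestronglyMeasurable (.of_forall fun ω => ?_)
    split_ifs <;> simp
  have heq : ∫ ω, W ω * z ^ D ω ∂P - (1 + (z - 1) * c) * ∫ ω, W ω ∂P =
      ∫ ω, W ω * (z ^ D ω - 1 - (z - 1) * D ω) ∂P := by
    have : ∀ ω, W ω * (z ^ D ω - 1 - (z - 1) * D ω) =
        W ω * z ^ D ω - W ω - (z - 1) * ((D ω : ℝ) • W ω) := fun ω => by
      rw [Complex.real_smul]; push_cast; ring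
    simp_rw [this]
    rw [integral_sub (f := fun ω => W ω * z ^ D ω - W ω) (hWz.sub hWi) (hDW.const_mul _),
      integral_sub hWz hWi, integral_const_mul,
      hpull]
    ring
  rw [heq, ← integral_const_mul]
  refine norm_integral_le_of_norm_le (hsmall.const_mul 3) (.of_forall fun ω => ?_)
  rw [norm_mul]
  exact (mul_le_of_le_one_left (norm_nonneg _) (hW1 ω)).trans (norm_pow_sub_one_sub_mul_le hz _)

/-- The `i`-th point of the partition of `[s, t]` into `m` intervals of equal length. -/
noncomputable def uniformPartition (s t : ℝ≥0) (m i : ℕ) : ℝ≥0 := s + i * ((t - s) / m)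

theorem uniformPartition_zero (s t : ℝ≥0) (m : ℕ) : uniformPartition s t m 0 = s := by
  simp [uniformPartition]

theorem uniformPartition_self {s t : ℝ≥0} (hst : s ≤ t) {m : ℕ} (hm : m ≠ 0) :
    uniformPartition s t m m = t := by
  have : (m : ℝ≥0) ≠ 0 := Nat.cast_ne_zero.2 hm
  rw [uniformPartition, mul_div_cancel₀ _ this, add_tsub_cancel_of_le hst]

theorem uniformPartition_succ (s t : ℝ≥0) (m i : ℕ) :
    uniformPartition s t m (i + 1) = uniformPartition s t m i + (t - s) / m := by
  simp only [uniformPartition]; push_cast; ring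

theorem uniformPartition_mono (s t : ℝ≥0) (m : ℕ) : Monotone (uniformPartition s t m) :=
  monotone_nat_of_le_succ fun i => by rw [uniformPartition_succ]; exact le_self_add

namespace IsCountingProcess

variable {Ω : Type*} {N : ℝ≥0 → Ω → ℕ}

/-- The total height of those increments over the uniform partition of `[s, t]` into `m` intervals
that are at least two. -/
noncomputable def largeIncrements (N : ℝ≥0 → Ω → ℕ) (s t : ℝ≥0) (m : ℕ) (ω : Ω) : ℝ :=
  ∑ i ∈ Finset.range m,
    let d := N (uniformPartition s t m (i + 1)) ω - N (uniformPartition s t m i) ω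
    if d ≤ 1 then 0 else (d : ℝ)

theorem largeIncrements_nonneg (s t : ℝ≥0) (m : ℕ) (ω : Ω) : 0 ≤ largeIncrements N s t m ω :=
  Finset.sum_nonneg fun i _ => by dsimp only; split_ifs <;> positivity

variable [MeasurableSpace Ω]

/-- A Lebesgue number of the cover of `[s, t]` by the balls of `exists_ball_le_add_one` bounds the
mesh below which every increment is at most one. -/
theorem eventually_largeIncrements_eq_zero (h : IsCountingProcess N) {s t : ℝ≥0} (hst : s ≤ t)
    (ω : Ω) : ∀ᶠ m in Filter.atTop, largeIncrements N s t m ω = 0 := by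
  choose ε hε hball using fun u => h.exists_ball_le_add_one u ω
  obtain ⟨δ, hδ, hcov⟩ := lebesgue_number_lemma_of_metric (s := Set.Icc s t)
    (c := fun u : ℝ≥0 => Metric.ball u (ε u)) isCompact_Icc (fun _ => Metric.isOpen_ball)
    (fun u _ => Set.mem_iUnion.2 ⟨u, Metric.mem_ball_self (hε u)⟩)
  have hlim : Filter.Tendsto (fun m : ℕ => ((t - s : ℝ≥0) : ℝ) / m) Filter.atTop (nhds 0) :=
    tendsto_const_div_atTop_nhds_zero_nat _
  filter_upwards [hlim.eventually_lt_const hδ, Filter.eventually_gt_atTop 0] with m hmδ hm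
  refine Finset.sum_eq_zero fun i hi => ?_
  have hi' : i < m := Finset.mem_range.1 hi
  have hmem : uniformPartition s t m i ∈ Set.Icc s t := by
    constructor
    · exact (uniformPartition_zero s t m).symm.le.trans
        (uniformPartition_mono s t m (Nat.zero_le i))
    · exact (uniformPartition_mono s t m hi'.le).trans (uniformPartition_self hst hm.ne').le
  obtain ⟨u, hu⟩ := hcov _ hmem
  refine if_pos ?_
  have := hball u _ (hu (Metric.mem_ball_self hδ)) (uniformPartition s t m (i + 1)) (hu ?_)
  · omega
  · rw [uniformPartition_succ, Metric.mem_ball, NNReal.dist_eq]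
    push_cast
    rwa [add_sub_cancel_left, abs_of_nonneg (by positivity)]

theorem cast_sub (h : IsCountingProcess N) {s t : ℝ≥0} (hst : s ≤ t) (ω : Ω) :
    ((N t ω - N s ω : ℕ) : ℝ) = N t ω - N s ω :=
  Nat.cast_sub (h.mono ω hst)

theorem largeIncrements_le (h : IsCountingProcess N) {s t : ℝ≥0} (hst : s ≤ t) (m : ℕ)
    (ω : Ω) : largeIncrements N s t m ω ≤ N t ω - N s ω := by
  rcases Nat.eq_zero_or_pos m with rfl | hm
  · simpa [largeIncrements] using h.mono ω hst
  calc largeIncrements N s t m ω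
      ≤ ∑ i ∈ Finset.range m, ((N (uniformPartition s t m (i + 1)) ω : ℝ) -
          N (uniformPartition s t m i) ω) := by
        refine Finset.sum_le_sum fun i _ => ?_
        have := h.cast_sub (uniformPartition_mono s t m (Nat.le_succ i)) ω
        dsimp only
        rw [← this]
        split_ifs <;> simp
    _ = N t ω - N s ω := by
        rw [Finset.sum_range_sub (fun i => (N (uniformPartition s t m i) ω : ℝ)),
          uniformPartition_zero, uniformPartition_self hst hm.ne']

theorem measurable_increment (h : IsCountingProcess N) (s t : ℝ≥0) :
    Measurable fun ω => N t ω - N s ω :=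
  (measurable_of_countable fun p : ℕ × ℕ => p.1 - p.2).comp
    ((h.measurable t).prodMk (h.measurable s))

theorem measurable_large_increment (h : IsCountingProcess N) (s t : ℝ≥0) :
    Measurable fun ω => if N t ω - N s ω ≤ 1 then 0 else ((N t ω - N s ω : ℕ) : ℝ) :=
  (measurable_from_nat (f := fun n => if n ≤ 1 then 0 else (n : ℝ))).comp
    (h.measurable_increment s t)

theorem tendsto_integral_largeIncrements (h : IsCountingProcess N) {P : Measure Ω}
    (hN : ∀ t, Integrable (fun ω => (N t ω : ℝ)) P) {s t : ℝ≥0} (hst : s ≤ t) :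
    Filter.Tendsto (fun m => ∫ ω, largeIncrements N s t m ω ∂P) Filter.atTop (nhds 0) := by
  rw [show (0 : ℝ) = ∫ _, (0 : ℝ) ∂P by simp]
  refine tendsto_integral_of_dominated_convergence (fun ω => (N t ω : ℝ) - N s ω)
    (fun m => ?_) ((hN t).sub (hN s)) (fun m => .of_forall fun ω => ?_)
    (.of_forall fun ω => ?_)
  · exact (Finset.measurable_fun_sum _ fun i _ =>
      h.measurable_large_increment _ _).aestronglyMeasurable
  · rw [Real.norm_of_nonneg (largeIncrements_nonneg s t m ω)]
    exact h.largeIncrements_le hst m ω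
  · exact tendsto_const_nhds.congr'
      ((h.eventually_largeIncrements_eq_zero hst ω).mono fun m hm => hm.symm)

end IsCountingProcess

end Watanabe

/-! ### Watanabe's theorem -/

namespace IsCountingProcess

variable {Ω : Type*} [MeasurableSpace Ω] {N : ℝ≥0 → Ω → ℕ} {P : Measure Ω} {θ : ℝ≥0}

theorem integrable_of_martingale [IsProbabilityMeasure P] (h : IsCountingProcess N)
    (hM : Martingale (fun t ω => (N t ω : ℝ) - (t : ℝ) * θ)
      (Filtration.natural N h.stronglyMeasurable) P) (t : ℝ≥0) :
    Integrable (fun ω => (N t ω : ℝ)) P := by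
  refine ((hM.integrable t).add (integrable_const ((t : ℝ) * θ))).congr (.of_forall fun ω => ?_)
  simp

theorem measurable_natural (h : IsCountingProcess N) {s t : ℝ≥0} (hst : s ≤ t) :
    Measurable[Filtration.natural N h.stronglyMeasurable t] (N s) :=
  (Filtration.stronglyAdapted_natural h.stronglyMeasurable s).measurable.mono
    ((Filtration.natural N h.stronglyMeasurable).mono hst) le_rfl

theorem condExp_increment_of_martingale [IsProbabilityMeasure P] (h : IsCountingProcess N)
    (hM : Martingale (fun t ω => (N t ω : ℝ) - (t : ℝ) * θ)
      (Filtration.natural N h.stronglyMeasurable) P) {u v : ℝ≥0} (huv : u ≤ v) :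
    P[fun ω => ((N v ω - N u ω : ℕ) : ℝ) | Filtration.natural N h.stronglyMeasurable u] =ᵐ[P]
      fun _ => ((θ * (v - u) : ℝ≥0) : ℝ) := by
  set F := Filtration.natural N h.stronglyMeasurable
  set M : ℝ≥0 → Ω → ℝ := fun t ω => (N t ω : ℝ) - (t : ℝ) * θ with hMdef
  have heq : (fun ω => ((N v ω - N u ω : ℕ) : ℝ)) =
      (M v - M u) + fun _ => ((θ * (v - u) : ℝ≥0) : ℝ) := by
    funext ω
    rw [h.cast_sub huv]
    simp only [hMdef, Pi.add_apply, Pi.sub_apply, NNReal.coe_mul, NNReal.coe_sub huv]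
    ring
  rw [heq]
  filter_upwards [condExp_add ((hM.integrable v).sub (hM.integrable u))
    (integrable_const ((θ * (v - u) : ℝ≥0) : ℝ)) (F u),
    condExp_sub (hM.integrable v) (hM.integrable u) (F u), hM.condExp_ae_eq huv,
    hM.condExp_ae_eq (le_refl u)] with ω h1 h2 h3 h4
  rw [h1, Pi.add_apply, h2, Pi.sub_apply, h3, h4, condExp_const (F.le u)]
  simp

theorem setIntegral_pow_increment [IsProbabilityMeasure P] (h : IsCountingProcess N)
    (hM : Martingale (fun t ω => (N t ω : ℝ) - (t : ℝ) * θ)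
      (Filtration.natural N h.stronglyMeasurable) P) {s t : ℝ≥0} (hst : s ≤ t) {A : Set Ω}
    (hA : MeasurableSet[Filtration.natural N h.stronglyMeasurable s] A) {z : ℂ} (hz : ‖z‖ ≤ 1) :
    ∫ ω in A, z ^ (N t ω - N s ω) ∂P =
      Complex.exp ((θ * (t - s) : ℝ≥0) * (z - 1)) * P.real A := by
  set F := Filtration.natural N h.stronglyMeasurable with hF
  have hA' : MeasurableSet A := F.le s A hA
  -- Keeping the indicator of `A` inside `W` yields the law of the increment and its independence of
  -- the past at once.
  set W : ℝ≥0 → Ω → ℂ := fun u => A.indicator fun ω => z ^ (N u ω - N s ω) with hWdef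
  have hW : ∀ u, s ≤ u → StronglyMeasurable[F u] (W u) := fun u hu => by
    refine StronglyMeasurable.indicator ?_ (F.mono hu A hA)
    refine Measurable.stronglyMeasurable ?_
    exact (measurable_of_countable fun p : ℕ × ℕ => z ^ (p.1 - p.2)).comp
      ((h.measurable_natural le_rfl).prodMk (h.measurable_natural hu))
  have hW1 : ∀ u ω, ‖W u ω‖ ≤ 1 := fun u ω => by
    refine (norm_indicator_le_norm_self _ _).trans ?_
    rw [norm_pow]
    exact pow_le_one₀ (norm_nonneg z) hz
  have hstep : ∀ u v, s ≤ u → u ≤ v → ∀ ω, W u ω * z ^ (N v ω - N u ω) = W v ω := by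
    intro u v hsu huv ω
    by_cases hω : ω ∈ A
    · simp only [hWdef, Set.indicator_of_mem hω, ← pow_add]
      have h1 := h.mono ω hsu
      have h2 := h.mono ω huv
      simp only at h1 h2
      congr 1
      omega
    · simp [hWdef, Set.indicator_of_notMem hω]
  have hNi := h.integrable_of_martingale hM
  have hDi : ∀ u v, u ≤ v → Integrable (fun ω => ((N v ω - N u ω : ℕ) : ℝ)) P := by
    intro u v huv
    simp_rw [h.cast_sub huv]
    exact (hNi v).sub (hNi u)
  have hbound : ∀ u v, s ≤ u → u ≤ v →
      ‖∫ ω, W v ω ∂P - (1 + (z - 1) * ((θ * (v - u) : ℝ≥0) : ℝ)) * ∫ ω, W u ω ∂P‖ ≤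
        3 * ∫ ω, (if N v ω - N u ω ≤ 1 then 0 else ((N v ω - N u ω : ℕ) : ℝ)) ∂P := by
    intro u v hsu huv
    have := norm_integral_mul_pow_sub_le (F.le u) (hW u hsu) (hW1 u)
      (h.measurable_increment u v) (hDi u v huv) (h.condExp_increment_of_martingale hM huv) hz
    simp only [hstep u v hsu huv] at this
    exact this
  set c : ℂ := (θ * (t - s) : ℝ≥0) * (z - 1) with hc
  have hlam : Filter.Tendsto (fun m : ℕ => ((θ * (t - s) : ℝ≥0) : ℝ) / m) Filter.atTop (nhds 0) :=
    tendsto_const_div_atTop_nhds_zero_nat _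
  have hev : ∀ᶠ m : ℕ in Filter.atTop,
      ‖∫ ω, W t ω ∂P - (1 + c / m) ^ m * ∫ ω, W s ω ∂P‖ ≤
        3 * ∫ ω, largeIncrements N s t m ω ∂P := by
    filter_upwards [hlam.eventually_le_const zero_lt_one, Filter.eventually_gt_atTop 0]
      with m hm1 hm
    -- For large `m` this is the convex combination `(1 - r) + r * z` of two points of the unit
    -- disc.
    have hq : ‖1 + c / m‖ ≤ 1 := by
      set r : ℝ := ((θ * (t - s) : ℝ≥0) : ℝ) / m with hr
      have hr0 : 0 ≤ r := by positivity
      have : 1 + c / m = ((1 - r : ℝ) : ℂ) + (r : ℝ) * z := by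
        rw [hc, hr]; push_cast; ring
      rw [this]
      refine (norm_add_le _ _).trans ?_
      rw [norm_mul, Complex.norm_of_nonneg hr0, Complex.norm_of_nonneg (sub_nonneg.2 hm1)]
      linarith [mul_le_of_le_one_right hr0 hz]
    have hmain := norm_sub_pow_mul_le (a := fun i => ∫ ω, W (uniformPartition s t m i) ω ∂P)
      (ε := fun i => 3 * ∫ ω, (fun d : ℕ => if d ≤ 1 then 0 else (d : ℝ))
        (N (uniformPartition s t m (i + 1)) ω - N (uniformPartition s t m i) ω) ∂P) hq m
      fun i _ => ?_
    · simp only [uniformPartition_zero, uniformPartition_self hst hm.ne'] at hmain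
      refine hmain.trans (le_of_eq ?_)
      rw [← Finset.mul_sum, ← integral_finsetSum]
      · rfl
      · intro i _
        have hi := hDi _ _ (uniformPartition_mono s t m (Nat.le_succ i))
        refine hi.mono' (h.measurable_large_increment _ _).aestronglyMeasurable
          (.of_forall fun ω => ?_)
        split_ifs <;> simp
    · have hsu : s ≤ uniformPartition s t m i :=
        (uniformPartition_zero s t m).symm.le.trans (uniformPartition_mono s t m (Nat.zero_le i))
      have := hbound _ _ hsu (uniformPartition_mono s t m (Nat.le_succ i))
      rw [Nat.succ_eq_add_one, uniformPartition_succ, add_tsub_cancel_left] at this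
      rw [uniformPartition_succ]
      convert this using 4
      rw [hc]; push_cast; ring
  have hlim : Filter.Tendsto
      (fun m : ℕ => ∫ ω, W t ω ∂P - (1 + c / m) ^ m * ∫ ω, W s ω ∂P) Filter.atTop (nhds 0) := by
    refine squeeze_zero_norm' hev ?_
    simpa using (h.tendsto_integral_largeIncrements hNi hst).const_mul 3
  have hlim' := tendsto_const_nhds (x := ∫ ω, W t ω ∂P) (f := Filter.atTop (α := ℕ)) |>.sub
    ((Complex.tendsto_one_add_div_pow_exp c).mul_const (∫ ω, W s ω ∂P))
  have hfin := sub_eq_zero.1 (tendsto_nhds_unique hlim' hlim)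
  have hWs : ∫ ω, W s ω ∂P = P.real A := by
    simp only [hWdef, tsub_self, pow_zero]
    rw [integral_indicator hA']
    simp
  rw [hWs, integral_indicator hA'] at hfin
  exact hfin

/-- Under the martingale property, the increments over `[s, t]` are Poisson distributed and
independent of the past. -/
theorem measure_inter_increment_of_martingale [IsProbabilityMeasure P] (h : IsCountingProcess N)
    (hM : Martingale (fun t ω => (N t ω : ℝ) - (t : ℝ) * θ)
      (Filtration.natural N h.stronglyMeasurable) P) {s t : ℝ≥0} (hst : s ≤ t) {A : Set Ω}
    (hA : MeasurableSet[Filtration.natural N h.stronglyMeasurable s] A) (B : Set ℕ) :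
    P (A ∩ (fun ω => N t ω - N s ω) ⁻¹' B) = P A * poissonMeasure (θ * (t - s)) B := by
  have hA' : MeasurableSet A := (Filtration.natural N h.stronglyMeasurable).le s A hA
  set r : ℝ≥0 := θ * (t - s)
  have hD := h.measurable_increment s t
  have hDr : Measurable fun ω => ((N t ω - N s ω : ℕ) : ℝ) := measurable_from_nat.comp hD
  -- The increment is cast to `ℝ` so that characteristic functions, i.e. `z` on the unit circle,
  -- identify its law under the restriction of `P` to `A`.
  have hmeas : (P.restrict A).map (fun ω => ((N t ω - N s ω : ℕ) : ℝ)) =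
      (P A).toNNReal • (poissonMeasure r).map (Nat.cast : ℕ → ℝ) := by
    refine Measure.ext_of_charFun (funext fun x => ?_)
    have hexp : ∀ ω, Complex.exp (((N t ω - N s ω : ℕ) : ℝ) * x * Complex.I) =
        Complex.exp (x * Complex.I) ^ (N t ω - N s ω) := fun ω => by
      rw [← Complex.exp_nat_mul]; push_cast; ring_nf
    have h1 := h.setIntegral_pow_increment hM hst hA
      (z := Complex.exp (x * Complex.I)) (by rw [Complex.norm_exp_ofReal_mul_I])
    have h2 := charFun_map_cast_poissonMeasure r x
    rw [charFun_apply_real] at h2 ⊢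
    rw [charFun_apply_real, integral_smul_nnreal_measure, h2,
      integral_map hDr.aemeasurable (by fun_prop)]
    simp only [mul_comm (x : ℂ), hexp] at h1 ⊢
    have hP : ((P A).toNNReal : ℝ) = P.real A := rfl
    rw [h1, NNReal.smul_def, hP, Complex.real_smul, mul_comm]
  have hinj : Function.Injective (Nat.cast : ℕ → ℝ) := Nat.cast_injective
  have hB : MeasurableSet ((Nat.cast : ℕ → ℝ) '' B) := (B.to_countable.image _).measurableSet
  have := congrArg (fun ν : Measure ℝ => ν (Nat.cast '' B)) hmeas
  simp only [Measure.smul_apply] at this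
  rw [Measure.map_apply hDr hB, Measure.map_apply measurable_from_nat hB,
    hinj.preimage_image, Measure.restrict_apply (hDr hB)] at this
  have hpre : (fun ω => ((N t ω - N s ω : ℕ) : ℝ)) ⁻¹' (Nat.cast '' B) =
      (fun ω => N t ω - N s ω) ⁻¹' B := by
    ext ω
    simp only [Set.mem_preimage, hinj.mem_set_image]
  rw [hpre, Set.inter_comm, ENNReal.smul_def, ENNReal.coe_toNNReal (measure_ne_top P A)] at this
  exact this

theorem map_increment_of_martingale [IsProbabilityMeasure P] (h : IsCountingProcess N)
    (hM : Martingale (fun t ω => (N t ω : ℝ) - (t : ℝ) * θ)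
      (Filtration.natural N h.stronglyMeasurable) P) {s t : ℝ≥0} (hst : s ≤ t) :
    P.map (fun ω => N t ω - N s ω) = poissonMeasure (θ * (t - s)) := by
  ext B hB
  have := h.measure_inter_increment_of_martingale hM hst MeasurableSet.univ B
  rwa [Set.univ_inter, measure_univ, one_mul,
    ← Measure.map_apply (h.measurable_increment s t) hB] at this

/-- **Watanabe's characterization**: a counting process whose compensator is `t ↦ t * θ` is a
Poisson process with parameter `θ`. -/
theorem isPoissonProcess_of_martingale [IsProbabilityMeasure P] (h : IsCountingProcess N)
    (hM : Martingale (fun t ω => (N t ω : ℝ) - (t : ℝ) * θ)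
      (Filtration.natural N h.stronglyMeasurable) P) : IsPoissonProcess P N θ where
  counting := h
  indepIncrements := by
    refine .of_nat fun t ht _ => ?_
    refine iIndepFun_of_indep_past (m := fun j => Filtration.natural N h.stronglyMeasurable (t j))
      (fun i j hij => ?_) (fun j => ?_)
    · exact (measurable_of_countable fun p : ℕ × ℕ => p.1 - p.2).comp
        ((h.measurable_natural (ht hij)).prodMk (h.measurable_natural (ht hij.le)))
    · rw [Indep_iff]
      rintro A _ hA ⟨B, hB, rfl⟩
      have hj := ht (Nat.le_succ j)
      rw [h.measure_inter_increment_of_martingale hM hj hA B,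
        ← Measure.map_apply (h.measurable_increment _ _) hB, h.map_increment_of_martingale hM hj]
  stationaryIncrements s t u hst := by
    rw [h.map_increment_of_martingale hM hst,
      h.map_increment_of_martingale hM (add_le_add_left hst u), add_tsub_add_eq_tsub_right]
  law t _ := by
    simpa [h.zero, mul_comm] using h.map_increment_of_martingale hM zero_le

end IsCountingProcess

/-! ### Mean and independence of Poisson increments -/

theorem lintegral_natCast_poissonMeasure (r : ℝ≥0) :
    ∫⁻ n, (n : ENNReal) ∂poissonMeasure r = r := by
  have hsum : HasSum (fun n : ℕ => Real.exp (-r) * r ^ n / n.factorial * (n : ℝ)) r := by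
    -- The term at `0` vanishes, and the shifted series is `r` times the total mass of the Poisson
    -- law.
    rw [← hasSum_nat_add_iff' 1]
    have h := (hasSum_one_poissonMeasure r).mul_left (r : ℝ)
    simp only [Finset.range_one, Finset.sum_singleton, CharP.cast_eq_zero, mul_zero, sub_zero]
    rw [mul_one] at h
    refine Eq.mp (congrArg (HasSum · (r : ℝ)) (funext fun n => ?_)) h
    rw [Nat.factorial_succ]
    have : ((n : ℝ) + 1) ≠ 0 := by positivity
    push_cast
    field_simp
    ring
  have hterm : ∀ n : ℕ, (n : ENNReal) * poissonMeasure r {n} =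
      ENNReal.ofReal (Real.exp (-r) * r ^ n / n.factorial * n) := fun n => by
    rw [poissonMeasure_singleton, mul_comm, ENNReal.ofReal_mul (by positivity),
      ENNReal.ofReal_natCast]
  rw [lintegral_countable']
  simp_rw [hterm]
  rw [← ENNReal.ofReal_tsum_of_nonneg (fun n => by positivity) hsum.summable, hsum.tsum_eq,
    ENNReal.ofReal_coe_nnreal]

namespace IsPoissonProcess

variable {Ω : Type*} [MeasurableSpace Ω] {P : Measure Ω} {N : ℝ≥0 → Ω → ℕ} {θ : ℝ≥0}

theorem map_increment [IsProbabilityMeasure P] (h : IsPoissonProcess P N θ) {s t : ℝ≥0}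
    (hst : s ≤ t) : P.map (fun ω => N t ω - N s ω) = poissonMeasure ((t - s) * θ) := by
  have h1 := h.stationaryIncrements 0 (t - s) s zero_le
  rw [tsub_add_cancel_of_le hst, zero_add] at h1
  rw [h1]
  simp only [h.counting.zero, tsub_zero]
  -- `law` only covers positive times; for `s = t` the Poisson law of parameter `0` is the Dirac
  -- mass at `0`.
  rcases hst.eq_or_lt with rfl | hlt
  · have : N (s - s) = fun _ => 0 := by funext ω; rw [tsub_self, h.counting.zero]
    rw [this, Measure.map_const, tsub_self, zero_mul, measure_univ, one_smul]
    refine Measure.ext_of_singleton fun n => ?_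
    rw [poissonMeasure_singleton]
    rcases eq_or_ne n 0 with rfl | hn
    · simp
    · simp [hn, hn.symm]
  · exact h.law _ (tsub_pos_of_lt hlt)

theorem lintegral_increment [IsProbabilityMeasure P] (h : IsPoissonProcess P N θ) {s t : ℝ≥0}
    (hst : s ≤ t) : ∫⁻ ω, ((N t ω - N s ω : ℕ) : ENNReal) ∂P = ((t - s) * θ : ℝ≥0) := by
  rw [← lintegral_natCast_poissonMeasure, ← h.map_increment hst,
    lintegral_map measurable_from_nat (h.counting.measurable_increment s t)]

/-- It suffices to treat finitely many past times; the values there are sums of increments over a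
grid ending at `s`, which are independent of the next increment. -/
theorem indep_natural_increment [IsProbabilityMeasure P] (h : IsPoissonProcess P N θ) {s t : ℝ≥0}
    (hst : s ≤ t) : Indep (Filtration.natural N h.counting.stronglyMeasurable s)
      (MeasurableSpace.comap (fun ω => N t ω - N s ω) inferInstance) P := by
  rw [Filtration.natural_eq_comap]
  change IndepFun (fun ω (j : Set.Iic s) => N j ω) (fun ω => N t ω - N s ω) P
  refine IndepFun.process_indepFun (fun j => h.counting.measurable j)
    (h.counting.measurable_increment s t) fun I => ?_
  -- Including `0` makes values sums of increments; including `s` makes the step after the last grid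
  -- point exactly `[s, t]`.
  set K : Finset ℝ≥0 := insert 0 (insert s (I.image Subtype.val)) with hK
  have hKs : ∀ x ∈ K, x ≤ s := by
    intro x hx
    simp only [hK, Finset.mem_insert, Finset.mem_image] at hx
    rcases hx with rfl | rfl | ⟨y, -, rfl⟩
    · exact zero_le
    · exact le_rfl
    · exact y.2
  have hKpos : 0 < K.card := Finset.card_pos.2 ⟨0, Finset.mem_insert_self _ _⟩
  obtain ⟨k, hk⟩ : ∃ k, K.card = k + 1 := ⟨K.card - 1, by omega⟩
  set e := K.orderEmbOfFin hk with he
  set τ : ℕ → ℝ≥0 := fun n => if hn : n < k + 1 then e ⟨n, hn⟩ else t with hτ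
  have hτe : ∀ n (hn : n < k + 1), τ n = e ⟨n, hn⟩ := fun n hn => dif_pos hn
  have hmono : Monotone τ := by
    refine monotone_nat_of_le_succ fun n => ?_
    by_cases h1 : n + 1 < k + 1
    · rw [hτe n (by omega), hτe (n + 1) h1]
      exact e.monotone (Nat.le_succ n)
    · have : τ (n + 1) = t := dif_neg h1
      rw [this]
      by_cases h2 : n < k + 1
      · rw [hτe n h2]
        exact (hKs _ (K.orderEmbOfFin_mem hk _)).trans hst
      · exact (dif_neg h2 : τ n = t).le
  have hτ0 : τ 0 = 0 := by
    rw [hτe 0 (Nat.succ_pos k), he, Finset.orderEmbOfFin_zero hk (Nat.succ_pos k)]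
    exact le_antisymm (K.min'_le 0 (Finset.mem_insert_self _ _)) zero_le
  have hτk : τ k = s := by
    rw [hτe k (Nat.lt_succ_self k)]
    have := Finset.orderEmbOfFin_last hk (Nat.succ_pos k)
    refine this.trans (le_antisymm (hKs _ (K.max'_mem _)) (K.le_max' s ?_))
    simp [hK]
  have hτt : τ (k + 1) = t := dif_neg (lt_irrefl _)
  set D : ℕ → Ω → ℕ := fun i ω => N (τ (i + 1)) ω - N (τ i) ω with hD
  have hND : ∀ n ω, N (τ n) ω = ∑ i ∈ Finset.range n, D i ω := by
    intro n ω
    induction n with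
    | zero => simp [hτ0, h.counting.zero]
    | succ n ih =>
      have := h.counting.mono ω (hmono (Nat.le_succ n))
      rw [Finset.sum_range_succ, ← ih]
      simp only [hD]
      exact (Nat.add_sub_cancel' this).symm
  have hidx : ∀ j : I, ∃ n ≤ k, τ n = (j : Set.Iic s) := by
    intro j
    have hj : ((j : Set.Iic s) : ℝ≥0) ∈ K := by
      simp only [hK, Finset.mem_insert]
      exact Or.inr (Or.inr (Finset.mem_image_of_mem _ j.2))
    have : ((j : Set.Iic s) : ℝ≥0) ∈ Set.range e := by
      rw [he, Finset.range_orderEmbOfFin]; exact hj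
    obtain ⟨n, hn⟩ := this
    exact ⟨n, Nat.le_of_lt_succ n.2, (hτe n n.2).trans hn⟩
  choose idx hidxk hidxτ using hidx
  have hind := (h.indepIncrements.nat hmono).indepFun_finset (Finset.range k) {k}
    (by simp) (fun i => h.counting.measurable_increment _ _)
  have hcomp := hind.comp
    (φ := fun d (j : I) => ∑ i ∈ Finset.range (idx j),
      if hi : i ∈ Finset.range k then d ⟨i, hi⟩ else 0)
    (ψ := fun d => d ⟨k, Finset.mem_singleton_self k⟩)
    (measurable_of_countable _) (measurable_of_countable _)
  convert hcomp using 1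
  · funext ω j
    simp only [Function.comp]
    rw [← hidxτ j, hND]
    refine Finset.sum_congr rfl fun i hi => ?_
    rw [dif_pos (Finset.mem_range.2 ((Finset.mem_range.1 hi).trans_le (hidxk j)))]
  · funext ω
    simp only [Function.comp, hτk, hτt]

end IsPoissonProcess

/-! ### The martingale property through nonnegative integrals -/

/-- Increments are nonnegative, so the martingale property can be tested with `∫⁻`, where no
integrability is needed beforehand: the case `s = 0`, `A = univ` supplies it. -/
theorem martingale_sub_mul_iff {Ω : Type*} [mΩ : MeasurableSpace Ω] {P : Measure Ω}
    [IsProbabilityMeasure P] {F : Filtration ℝ≥0 mΩ} {Y : ℝ≥0 → Ω → ℝ} (hY : StronglyAdapted F Y)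
    (hmono : ∀ ω, Monotone fun t => Y t ω) (h0 : ∀ ω, Y 0 ω = 0) {κ : ℝ} (hκ : 0 ≤ κ) :
    Martingale (fun t ω => Y t ω - (t : ℝ) * κ) F P ↔
      ∀ s t, s ≤ t → ∀ A, MeasurableSet[F s] A →
        ∫⁻ ω in A, ENNReal.ofReal (Y t ω - Y s ω) ∂P = ENNReal.ofReal ((t - s) * κ) * P A := by
  have hnn : ∀ s t, s ≤ t → ∀ ω, 0 ≤ Y t ω - Y s ω := fun s t hst ω =>
    sub_nonneg.2 (hmono ω hst)
  have hYm : ∀ t, AEStronglyMeasurable (Y t) P := fun t =>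
    ((hY t).mono (F.le t)).aestronglyMeasurable
  have hset : (∀ t, Integrable (Y t) P) → ∀ s t, s ≤ t → ∀ A, MeasurableSet[F s] A →
      (∫⁻ ω in A, ENNReal.ofReal (Y t ω - Y s ω) ∂P = ENNReal.ofReal ((t - s) * κ) * P A ↔
        ∫ ω in A, Y s ω - s * κ ∂P = ∫ ω in A, Y t ω - t * κ ∂P) := by
    intro hint s t hst A hA
    have hts : 0 ≤ ((t : ℝ) - s) * κ := mul_nonneg (sub_nonneg.2 (NNReal.coe_le_coe.2 hst)) hκ
    rw [← ofReal_integral_eq_lintegral_ofReal (f := fun ω => Y t ω - Y s ω)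
      ((hint t).sub (hint s)).integrableOn
      (.of_forall (hnn s t hst)), ← ofReal_measureReal (measure_ne_top P A),
      ← ENNReal.ofReal_mul hts,
      ENNReal.ofReal_eq_ofReal_iff (integral_nonneg (hnn s t hst))
        (mul_nonneg hts measureReal_nonneg),
      integral_sub (hint t).integrableOn (hint s).integrableOn,
      integral_sub (hint t).integrableOn (integrable_const _),
      integral_sub (hint s).integrableOn (integrable_const _), setIntegral_const,
      setIntegral_const, smul_eq_mul, smul_eq_mul]
    constructor <;> intro h <;> linarith
  constructor
  · intro hM s t hst A hA
    have hint : ∀ t, Integrable (Y t) P := fun t =>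
      ((hM.integrable t).add (integrable_const ((t : ℝ) * κ))).congr
        (.of_forall fun ω => by simp)
    exact (hset hint s t hst A hA).2 (hM.setIntegral_eq hst hA)
  · intro H
    have hint : ∀ t, Integrable (Y t) P := by
      intro t
      refine ⟨hYm t, ?_⟩
      have h1 := H 0 t zero_le Set.univ MeasurableSet.univ
      rw [hasFiniteIntegral_iff_ofReal (.of_forall fun ω => ?_)]
      · simp only [h0, sub_zero, Measure.restrict_univ] at h1
        rw [h1]
        exact ENNReal.mul_lt_top ENNReal.ofReal_lt_top (measure_lt_top P _)
      · simpa [h0] using hmono ω zero_le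
    have hint' : ∀ t : ℝ≥0, Integrable (fun ω => Y t ω - t * κ) P := fun t =>
      (hint t).sub (integrable_const _)
    refine ⟨fun t => (hY t).sub stronglyMeasurable_const, fun s t hst => ?_⟩
    refine (ae_eq_condExp_of_forall_setIntegral_eq (F.le s) (hint' t)
      (fun A _ _ => (hint' s).integrableOn) (fun A hA _ => ?_)
      ((hY s).sub stronglyMeasurable_const).aestronglyMeasurable).symm
    exact (hset hint s t hst A hA).1 (H s t hst A hA)

/-! ### Wald's identity on the past of the aggregate process -/

theorem ENNReal.sum_Ico_eq_tsum_indicator (g : ℕ → ENNReal) (a b : ℕ) :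
    ∑ k ∈ Finset.Ico a b, g k = ∑' k, g k * (Set.Ico a b).indicator (fun _ => 1) k := by
  rw [tsum_eq_sum (s := Finset.Ico a b)]
  · refine Finset.sum_congr rfl fun k hk => ?_
    rw [Set.indicator_of_mem (Set.mem_Ico.2 (Finset.mem_Ico.1 hk)), mul_one]
  · intro k hk
    rw [Set.indicator_of_notMem (fun h => hk (Finset.mem_Ico.2 (Set.mem_Ico.1 h))), mul_zero]

section Measurability

variable {Ω : Type*} [MeasurableSpace Ω] {M : Ω → ℕ} {X : ℕ → Ω → ℝ}

theorem measurable_sum_range_of_measurable (hM : Measurable M) (hX : ∀ i, Measurable (X i)) :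
    Measurable fun ω => ∑ k ∈ Finset.range (M ω), X k ω :=
  (measurable_from_prod_countable_right
    (f := fun p : ℕ × Ω => ∑ k ∈ Finset.range p.1, X k p.2)
    (fun n => Finset.measurable_fun_sum (Finset.range n) (fun k _ => hX k))).comp
      (hM.prodMk measurable_id)

theorem measurable_sum_range_ite_lt {k : ℕ} (hM : Measurable M)
    (hX : ∀ i < k, Measurable (X i)) :
    Measurable fun ω => ∑ j ∈ Finset.range k, if j < M ω then X j ω else 0 :=
  Finset.measurable_fun_sum _ fun j hj => Measurable.ite (hM (measurableSet_Ioi (a := j)))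
    (hX j (Finset.mem_range.1 hj)) measurable_const

end Measurability

namespace IsRiskProcess

variable {Ω : Type*} [mΩ : MeasurableSpace Ω] {P : Measure Ω} {N : ℝ≥0 → Ω → ℕ} {X : ℕ → Ω → ℝ}

theorem aggregateProcess_sub (hNX : IsRiskProcess P N X) {s t : ℝ≥0} (hst : s ≤ t) (ω : Ω) :
    ENNReal.ofReal (aggregateProcess N X t ω - aggregateProcess N X s ω) =
      ∑' k, ENNReal.ofReal (X k ω) * (Set.Ico (N s ω) (N t ω)).indicator (fun _ => 1) k := by
  rw [← ENNReal.sum_Ico_eq_tsum_indicator,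
    ← ENNReal.ofReal_sum_of_nonneg fun k _ => (hNX.pos k ω).le,
    Finset.sum_Ico_eq_sub _ (hNX.counting.mono ω hst)]
  rfl

/-- Up to the event `{N_s ≤ k}`, the past of the aggregate process only involves the counting
process and the first `k` claim sizes. -/
theorem measurableSet_inter_le (hNX : IsRiskProcess P N X) {s : ℝ≥0} {A : Set Ω}
    (hA : MeasurableSet[Filtration.natural _ hNX.stronglyMeasurable_aggregateProcess s] A) (k : ℕ) :
    MeasurableSet[(⨆ t, MeasurableSpace.comap (N t) inferInstance) ⊔
      ⨆ i ∈ Set.Iio k, MeasurableSpace.comap (X i) inferInstance] (A ∩ {ω | N s ω ≤ k}) := by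
  have hmono := hNX.counting.mono
  set F := Filtration.natural _ hNX.stronglyMeasurable_aggregateProcess with hF
  set G : MeasurableSpace Ω := (⨆ t, MeasurableSpace.comap (N t) inferInstance) ⊔
      ⨆ i ∈ Set.Iio k, MeasurableSpace.comap (X i) inferInstance with hG
  have hN : ∀ t, Measurable[G] (N t) := fun t => measurable_iff_comap_le.2
    ((le_iSup (fun t => MeasurableSpace.comap (N t) inferInstance) t).trans le_sup_left)
  have hX : ∀ i < k, Measurable[G] (X i) := fun i hi => measurable_iff_comap_le.2
    ((le_iSup₂ (f := fun i (_ : i ∈ Set.Iio k) => MeasurableSpace.comap (X i) inferInstance)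
      i hi).trans le_sup_right)
  set E : Set Ω := {ω | N s ω ≤ k} with hE
  have hEm : MeasurableSet[G] E := hN s (measurableSet_Iic (a := k))
  -- Compare traces on `E`: there `N u ≤ k` for every `u ≤ s`, so the random sum equals a truncated
  -- sum over the fixed range `k`.
  have hle : F s ≤
      (G.comap ((↑) : E → Ω)).map ((↑) : E → Ω) := by
    refine iSup₂_le fun u hu => ?_
    rintro _ ⟨B, hB, rfl⟩
    have hsum := measurable_sum_range_ite_lt (hN u) hX
    refine ⟨_, hsum hB, ?_⟩
    ext ⟨ω, hω⟩
    have hk : N u ω ≤ k := (hmono ω hu).trans hω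
    have : ∑ j ∈ Finset.range k, (if j < N u ω then X j ω else 0) = aggregateProcess N X u ω := by
      rw [← Finset.sum_filter]
      refine Finset.sum_congr ?_ fun _ _ => rfl
      ext j
      simp only [Finset.mem_filter, Finset.mem_range]
      omega
    simp only [Set.mem_preimage, this]
  obtain ⟨C, hC, hCA⟩ := hle A hA
  have : A ∩ E = C ∩ E := by
    ext ω
    simp only [Set.mem_inter_iff, and_congr_left_iff]
    intro hω
    exact (Set.ext_iff.1 hCA ⟨ω, hω⟩).symm
  rw [this]
  exact hC.inter hEm

theorem indep_counting_past [IsProbabilityMeasure P] (hNX : IsRiskProcess P N X) (k : ℕ) :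
    Indep ((⨆ t, MeasurableSpace.comap (N t) inferInstance) ⊔
      ⨆ i ∈ Set.Iio k, MeasurableSpace.comap (X i) inferInstance)
      (MeasurableSpace.comap (X k) inferInstance) P := by
  have hXle : ∀ i, MeasurableSpace.comap (X i) inferInstance ≤ mΩ := fun i =>
    (hNX.measurable i).comap_le
  have hind : Indep (⨆ t, MeasurableSpace.comap (N t) inferInstance)
      (⨆ i, MeasurableSpace.comap (X i) inferInstance) P := by
    rw [← MeasurableSpace.comap_process_pi, ← MeasurableSpace.comap_process_pi]
    exact hNX.indepFun
  refine Indep.sup_left_of_indep_sup (iSup_le fun t => (hNX.counting.measurable t).comap_le)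
    (iSup₂_le fun i _ => hXle i) (hXle k) (indep_of_indep_of_le_right hind ?_) ?_
  · exact sup_le (iSup₂_le fun i _ => le_iSup_of_le i le_rfl) (le_iSup_of_le k le_rfl)
  · have := indep_iSup_of_disjoint hXle hNX.iIndepFun.iIndep (S := Set.Iio k) (T := {k}) (by simp)
    simpa only [Set.mem_singleton_iff, iSup_iSup_eq_left] using this

/-- Wald's identity for the increments of the aggregate process over the events of its past. -/
theorem setLIntegral_aggregateProcess_sub [IsProbabilityMeasure P] (hNX : IsRiskProcess P N X)
    {s t : ℝ≥0} (hst : s ≤ t) {A : Set Ω}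
    (hA : MeasurableSet[Filtration.natural _ hNX.stronglyMeasurable_aggregateProcess s] A) :
    ∫⁻ ω in A, ENNReal.ofReal (aggregateProcess N X t ω - aggregateProcess N X s ω) ∂P =
      (∫⁻ ω, ENNReal.ofReal (X 0 ω) ∂P) * ∫⁻ ω in A, ((N t ω - N s ω : ℕ) : ENNReal) ∂P := by
  have hA' : MeasurableSet A :=
    (Filtration.natural _ hNX.stronglyMeasurable_aggregateProcess).le s A hA
  have hEm : ∀ k, MeasurableSet {ω | k ∈ Set.Ico (N s ω) (N t ω)} := fun k =>
    ((hNX.counting.measurable s) (measurableSet_Iic (a := k))).inter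
      ((hNX.counting.measurable t) (measurableSet_Ioi (a := k)))
  have hind : ∀ k, Measurable fun ω =>
      (Set.Ico (N s ω) (N t ω)).indicator (fun _ => (1 : ENNReal)) k :=
    fun k => (measurable_const (a := (1 : ENNReal))).indicator (hEm k)
  have hXm : ∀ k, Measurable fun ω => ENNReal.ofReal (X k ω) := fun k =>
    (hNX.measurable k).ennreal_ofReal
  have hcount : ∀ ω, ((N t ω - N s ω : ℕ) : ENNReal) =
      ∑' k, 
      (Set.Ico (N s ω) (N t ω)).indicator (fun _ => (1 : ENNReal)) k := fun ω => by
    have := ENNReal.sum_Ico_eq_tsum_indicator (fun _ => 1) (N s ω) (N t ω)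
    simpa only [one_mul, Finset.sum_const, Nat.card_Ico, nsmul_eq_mul, mul_one] using this
  have hterm : ∀ k, ∫⁻ ω in A, ENNReal.ofReal (X k ω) *
      (Set.Ico (N s ω) (N t ω)).indicator (fun _ => 1) k ∂P = (∫⁻ ω, ENNReal.ofReal (X 0 ω) ∂P) *
        ∫⁻ ω in A, (Set.Ico (N s ω) (N t ω)).indicator (fun _ => 1) k ∂P := by
    intro k
    -- On `T` the size `X k` is claimed after `s`, so `T` involves only `N` and the sizes before `X
    -- k`, and is independent of `X k`.
    set T : Set Ω := A ∩ {ω | k ∈ Set.Ico (N s ω) (N t ω)} with hT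
    have hTG : MeasurableSet[(⨆ t, MeasurableSpace.comap (N t) inferInstance) ⊔
        ⨆ i ∈ Set.Iio k, MeasurableSpace.comap (X i) inferInstance] T := by
      have hTeq : T = (A ∩ {ω | N s ω ≤ k}) ∩ {ω | k < N t ω} := by
        ext ω
        simp only [hT, Set.mem_inter_iff, Set.mem_ofPred_eq, Set.mem_Ico, and_assoc]
      have hlt : MeasurableSet[(⨆ t, MeasurableSpace.comap (N t) inferInstance) ⊔
          ⨆ i ∈ Set.Iio k, MeasurableSpace.comap (X i) inferInstance] {ω | k < N t ω} :=
        ((le_iSup (fun t => MeasurableSpace.comap (N t) inferInstance) t).trans le_sup_left) _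
          ⟨Set.Ioi k, measurableSet_Ioi, rfl⟩
      rw [hTeq]
      exact (hNX.measurableSet_inter_le hA k).inter hlt
    have hindT : ∀ ω, A.indicator
        (fun ω => (Set.Ico (N s ω) (N t ω)).indicator (fun _ => (1 : ENNReal)) k) ω =
          T.indicator (fun _ => 1) ω := fun ω => by
      by_cases h1 : ω ∈ A
      · by_cases h2 : k ∈ Set.Ico (N s ω) (N t ω)
        · rw [Set.indicator_of_mem h1, Set.indicator_of_mem h2,
            Set.indicator_of_mem (Set.mem_inter h1 h2)]
        · rw [Set.indicator_of_mem h1, Set.indicator_of_notMem h2,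
            Set.indicator_of_notMem fun h => h2 h.2]
      · rw [Set.indicator_of_notMem h1, Set.indicator_of_notMem fun h => h1 h.1]
    have hfac := lintegral_mul_indicator_eq_lintegral_mul_lintegral_indicator
      (hNX.measurable k).comap_le 1 (hA'.inter (hEm k)) (μ := P)
      (f := fun ω => ENNReal.ofReal (X k ω)) ?_
      ((comap_measurable (X k)).ennreal_ofReal)
    · have hid : ∫⁻ ω, ENNReal.ofReal (X k ω) ∂P = ∫⁻ ω, ENNReal.ofReal (X 0 ω) ∂P :=
        ((hNX.identDistrib k).comp ENNReal.measurable_ofReal).lintegral_eq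
      rw [← hid, ← lintegral_indicator hA', ← lintegral_indicator hA']
      simp only [hindT]
      refine Eq.trans (lintegral_congr fun ω => ?_) hfac
      rw [← hindT]
      by_cases h1 : ω ∈ A <;> simp [Set.indicator, h1]
    · rw [IndepSets_iff]
      rintro B _ hB rfl
      have := (Indep_iff _ _ _).1 (hNX.indep_counting_past k) T B hTG hB
      rw [Set.inter_comm, this, mul_comm]
  simp_rw [hNX.aggregateProcess_sub hst, hcount]
  rw [lintegral_tsum fun k => Measurable.aemeasurable ((hXm k).fun_mul (hind k)),
    lintegral_tsum fun k => (hind k).aemeasurable, ← ENNReal.tsum_mul_left]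
  exact tsum_congr hterm

theorem natural_aggregateProcess_le (hNX : IsRiskProcess P N X) (s : ℝ≥0) :
    Filtration.natural _ hNX.stronglyMeasurable_aggregateProcess s ≤
      (⨆ i, MeasurableSpace.comap (X i) inferInstance) ⊔
        Filtration.natural N hNX.counting.stronglyMeasurable s := by
  have hNs := fun u (hu : u ≤ s) => hNX.counting.measurable_natural hu
  set G := (⨆ i, MeasurableSpace.comap (X i) inferInstance) ⊔
    Filtration.natural N hNX.counting.stronglyMeasurable s
  refine iSup₂_le fun u hu => Measurable.comap_le ?_
  have hX : ∀ i, Measurable[G] (X i) := fun i => measurable_iff_comap_le.2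
    ((le_iSup (fun i => MeasurableSpace.comap (X i) inferInstance) i).trans le_sup_left)
  have hN : Measurable[G] (N u) := (hNs u hu).mono le_sup_right le_rfl
  exact measurable_sum_range_of_measurable hN hX

/-- The past of `S` lies in the σ-algebra of all sizes joined with the past of `N`. This join is
independent of the increment, so the integral factors. -/
theorem setLIntegral_increment_of_isPoissonProcess [IsProbabilityMeasure P]
    (hNX : IsRiskProcess P N X) {θ : ℝ≥0} (hN : IsPoissonProcess P N θ) {s t : ℝ≥0} (hst : s ≤ t)
    {A : Set Ω}
    (hA : MeasurableSet[Filtration.natural _ hNX.stronglyMeasurable_aggregateProcess s] A) :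
    ∫⁻ ω in A, ((N t ω - N s ω : ℕ) : ENNReal) ∂P = ((t - s) * θ : ℝ≥0) * P A := by
  have hA' : MeasurableSet A :=
    (Filtration.natural _ hNX.stronglyMeasurable_aggregateProcess).le s A hA
  have hD := hNX.counting.measurable_increment s t
  have hXle : (⨆ i, MeasurableSpace.comap (X i) inferInstance) ≤ mΩ :=
    iSup_le fun i => (hNX.measurable i).comap_le
  have hind : Indep (⨆ i, MeasurableSpace.comap (X i) inferInstance)
      (⨆ t, MeasurableSpace.comap (N t) inferInstance) P := by
    rw [← MeasurableSpace.comap_process_pi, ← MeasurableSpace.comap_process_pi]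
    exact hNX.indepFun.symm
  have hNt : ∀ u, Measurable[⨆ t, MeasurableSpace.comap (N t) inferInstance] (N u) := fun u =>
    measurable_iff_comap_le.2 (le_iSup (fun t => MeasurableSpace.comap (N t) inferInstance) u)
  have hDN : Measurable[⨆ t, MeasurableSpace.comap (N t) inferInstance]
      fun ω => N t ω - N s ω :=
    (measurable_of_countable fun p : ℕ × ℕ => p.1 - p.2).comp ((hNt t).prodMk (hNt s))
  have key := Indep.sup_left_of_indep_sup hXle
    ((Filtration.natural N hNX.counting.stronglyMeasurable).le s) hD.comap_le
    (indep_of_indep_of_le_right hind (sup_le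
      (iSup₂_le fun u _ => le_iSup (fun t => MeasurableSpace.comap (N t) inferInstance) u)
      hDN.comap_le))
    (hN.indep_natural_increment hst)
  have hfac := lintegral_mul_indicator_eq_lintegral_mul_lintegral_indicator
    hD.comap_le 1 hA' (μ := P) (f := fun ω => ((N t ω - N s ω : ℕ) : ENNReal)) ?_
    (measurable_from_nat.comp (comap_measurable _))
  · rw [hN.lintegral_increment hst, lintegral_indicator_const hA', one_mul] at hfac
    rw [← hfac, ← lintegral_indicator hA']
    refine lintegral_congr fun ω => ?_
    by_cases h1 : ω ∈ A <;> simp [Set.indicator, h1]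
  · rw [IndepSets_iff]
    intro B T hB hT
    have := (Indep_iff _ _ _).1 key A B (hNX.natural_aggregateProcess_le s A hA) hB
    rw [Set.mem_singleton_iff.1 hT, Set.inter_comm, this, mul_comm]

end IsRiskProcess

theorem corollary3p5 {Ω : Type*} [MeasurableSpace Ω] (P : Measure Ω) [IsProbabilityMeasure P]
    (N : ℝ≥0 → Ω → ℕ) (X : ℕ → Ω → ℝ) (hNX : IsRiskProcess P N X)
    (hX : Integrable (X 0) P) (θ₀ : ℝ≥0) (hθ₀ : 0 < θ₀) :
    List.TFAE [
      IsCompoundPoissonProcess P (aggregateProcess N X) θ₀ (P.map (X 0)),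
      Martingale (fun t ω => aggregateProcess N X t ω - (t : ℝ) * θ₀ * ∫ ω', X 0 ω' ∂P)
        (Filtration.natural (aggregateProcess N X) hNX.stronglyMeasurable_aggregateProcess) P,
      Martingale (fun t ω => (N t ω : ℝ) - (t : ℝ) * θ₀)
        (Filtration.natural N hNX.counting.stronglyMeasurable) P,
      IsPoissonProcess P N θ₀] := by
  have hpos : 0 < ∫ ω, X 0 ω ∂P := by
    rw [integral_pos_iff_support_of_nonneg (fun ω => (hNX.pos 0 ω).le) hX]
    have : Function.support (X 0) = Set.univ := Set.eq_univ_of_forall fun ω => (hNX.pos 0 ω).ne'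
    rw [this, measure_univ]
    exact one_pos
  have hmean : ∫⁻ ω, ENNReal.ofReal (X 0 ω) ∂P = ENNReal.ofReal (∫ ω, X 0 ω ∂P) :=
    (ofReal_integral_eq_lintegral_ofReal hX (.of_forall fun ω => (hNX.pos 0 ω).le)).symm
  -- Wald's identity and cancellation of the mean size turn (ii) into a condition on `N` alone,
  -- tested on the larger filtration of `S`.
  have hSmart : Martingale
      (fun t ω => aggregateProcess N X t ω - (t : ℝ) * θ₀ * ∫ ω', X 0 ω' ∂P)
      (Filtration.natural (aggregateProcess N X) hNX.stronglyMeasurable_aggregateProcess) P ↔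
      ∀ s t, s ≤ t → ∀ A,
        MeasurableSet[Filtration.natural _ hNX.stronglyMeasurable_aggregateProcess s] A →
        ∫⁻ ω in A, ((N t ω - N s ω : ℕ) : ENNReal) ∂P = ((t - s) * θ₀ : ℝ≥0) * P A := by
    simp_rw [mul_assoc]
    refine (martingale_sub_mul_iff
      (Filtration.stronglyAdapted_natural hNX.stronglyMeasurable_aggregateProcess)
      hNX.aggregateProcess_mono (fun ω => by simp [aggregateProcess, hNX.counting.zero])
      (mul_nonneg θ₀.coe_nonneg hpos.le)).trans ?_
    refine forall₅_congr fun s t hst A hA => ?_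
    rw [hNX.setLIntegral_aggregateProcess_sub hst hA, hmean, ← mul_assoc,
      mul_comm _ (∫ ω, X 0 ω ∂P), ENNReal.ofReal_mul hpos.le, mul_assoc,
      ENNReal.mul_right_inj (ENNReal.ofReal_pos.2 hpos).ne' ENNReal.ofReal_ne_top,
      ← NNReal.coe_sub hst, ← NNReal.coe_mul, ENNReal.ofReal_coe_nnreal]
  tfae_have 1 ↔ 4 := hNX.isCompoundPoissonProcess_iff θ₀
  tfae_have 4 → 2 := fun h => hSmart.2 fun s t hst A hA =>
    hNX.setLIntegral_increment_of_isPoissonProcess h hst hA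
  tfae_have 2 → 3 := fun h => by
    have hadapted : StronglyAdapted (Filtration.natural N hNX.counting.stronglyMeasurable)
        fun t ω => (N t ω : ℝ) := fun t =>
      (measurable_from_nat.comp (hNX.counting.measurable_natural le_rfl)).stronglyMeasurable
    refine (martingale_sub_mul_iff hadapted
      (fun ω s t hst => Nat.cast_le.2 (hNX.counting.mono ω hst))
      (fun ω => by simp [hNX.counting.zero]) θ₀.coe_nonneg).2 fun s t hst A hA => ?_
    have := hSmart.1 h s t hst A (hNX.natural_le_natural_aggregateProcess s A hA)
    simp_rw [← hNX.counting.cast_sub hst, ENNReal.ofReal_natCast]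
    rw [this, ← NNReal.coe_sub hst, ← NNReal.coe_mul, ENNReal.ofReal_coe_nnreal]
  tfae_have 3 → 4 := hNX.counting.isPoissonProcess_of_martingale
  tfae_finish
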